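/- **Corollary.** There exists a one-dimensional number-conserving cellular automaton that is intrinsically universal, i.e. that simulates every one-dimensional cellular automaton. Here a one-dimensional cellular automaton (CA) $F$ consists of a finite set of states $S$, a finite neighborhood $N\subset\mathbb Z$ and a local rule $f:S^N\to S$; its global map, also denoted $F:S^{\mathbb Z}\to S^{\mathbb Z}$, is $F(c)_i=f\big((c_{i+j})_{j\in N}\big)$. A CA $F$ with $S\subset\mathbb Z$ is *number-conserving* if for every periodic configuration $c\in S^{\mathbb Z}$ and every period $p\ge 1$ of $c$ (that is, $c_{i+p}=c_i$ for all $i\in\mathbb Z$), $$\sum_{0\le k<p}c_k=\sum_{0\le k<p}F(c)_k .$$ A CA $G$ with states $S_G$ is a *sub-automaton* of a CA $H$ with states $S_H$ if there is an injective map $\varphi:S_G\to S_H$ such that, applying $\varphi$ cell by cell, $\varphi(G(c))=H(\varphi(c))$ for all $c\in S_G^{\mathbb Z}$. Let $\sigma(c)_i=c_{i+1}$ be the shift, and for $m\ge 1$ let $o^m:S^{\mathbb Z}\to(S^m)^{\mathbb Z}$ be the bijection $o^m(c)_i=(c_{mi},\dots,c_{mi+m-1})$. For integers $m,n\ge 1$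 and $k\in\mathbb Z$, the $\langle m,n,k\rangle$-*rescaling* of a CA $F$ with states $S$ is the CA with states $S^m$ and global map $\sigma^k\circ o^m\circ F^n\circ(o^m)^{-1}$. A CA $F$ *simulates* a CA $G$ if $G$ is a sub-automaton of some rescaling of $F$, and $F$ is *intrinsically universal* if it simulates every one-dimensional CA. -/

import Mathlib

universe u v

/-- A one-dimensional cellular automaton with finite state set `S`: a finite neighborhood
`N ⊂ ℤ` and a local transition rule `S^N → S`. -/
structure CellularAutomaton (S : Type u) [Finite S] where
  nbhd : Finset ℤ
  rule : (nbhd → S) → S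

namespace CellularAutomaton

/-- The global map `S^ℤ → S^ℤ`, `F(c)_i = f(c|_{i+N})`. -/
def globalMap {S : Type u} [Finite S] (F : CellularAutomaton S) (c : ℤ → S) : ℤ → S :=
  fun i => F.rule (fun j => c (i + (j : ℤ)))

/-- `F` is a sub-automaton of `G`: there is an injective map `φ` on states which, applied
cellwise, intertwines the two global maps. -/
def IsSubAutomaton {S : Type u} {T : Type v} [Finite S] [Finite T]
    (F : CellularAutomaton S) (G : CellularAutomaton T) : Prop :=
  ∃ φ : S → T, Function.Injective φ ∧
    ∀ c : ℤ → S, φ ∘ F.globalMap c = G.globalMap (φ ∘ c)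

/-- The `k`-th power (`k ∈ ℤ`) of the shift, `σ^k(c)_i = c_{i+k}`. -/
def shift {S : Type u} (k : ℤ) (c : ℤ → S) : ℤ → S :=
  fun i => c (i + k)

/-- The (bijective) packing map `o^m : S^ℤ → (S^m)^ℤ`,
`o^m(c)_i = (c_{mi}, …, c_{mi+m-1})`, for `m > 0`. -/
def pack {S : Type u} (m : ℕ) [NeZero m] : (ℤ → S) ≃ (ℤ → (Fin m → S)) where
  toFun c := fun i j => c ((m : ℤ) * i + (j : ℕ))
  invFun d := fun i => d (Int.divModEquiv m i).1 (Int.divModEquiv m i).2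
  left_inv c := by
    funext i
    have h := (Int.divModEquiv m).symm_apply_apply i
    rw [Int.divModEquiv_symm_apply] at h
    exact congrArg c ((congrArg (· + _) (mul_comm _ _)).trans h)
  right_inv d := by
    funext i j
    have h := (Int.divModEquiv m).apply_symm_apply (i, j)
    rw [Int.divModEquiv_symm_apply] at h
    have e : (m : ℤ) * i + (j : ℕ) = i * m + (j : ℕ) := by ring
    show d (Int.divModEquiv m ((m : ℤ) * i + (j : ℕ))).1
      (Int.divModEquiv m ((m : ℤ) * i + (j : ℕ))).2 = d i j
    rw [e, h]

/-- The cellular automaton `H`, with states `S^m`, is the `⟨m, n, k⟩`-rescaling of `F`: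
`H = σ^k ∘ o^m ∘ F^n ∘ (o^m)⁻¹`. -/
def IsRescaling {S : Type u} [Finite S] (F : CellularAutomaton S) (m : ℕ) [NeZero m]
    (n : ℕ) (k : ℤ) (H : CellularAutomaton (Fin m → S)) : Prop :=
  ∀ c : ℤ → (Fin m → S),
    H.globalMap c = shift k (pack m (F.globalMap^[n] ((pack m).symm c)))

/-- `F` simulates `G`: `G` is a sub-automaton of some rescaling of `F`. -/
def Simulates {S : Type u} {T : Type v} [Finite S] [Finite T]
    (F : CellularAutomaton S) (G : CellularAutomaton T) : Prop :=
  ∃ (m : ℕ) (_ : NeZero m) (n : ℕ) (k : ℤ) (H : CellularAutomaton (Fin m → S)),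
    0 < n ∧ F.IsRescaling m n k H ∧ G.IsSubAutomaton H

/-- `F` is intrinsically universal: it simulates every one-dimensional cellular automaton. -/
def IntrinsicallyUniversal {S : Type u} [Finite S] (F : CellularAutomaton S) : Prop :=
  ∀ (T : Type v) [Finite T] (G : CellularAutomaton T), F.Simulates G

/-- A cellular automaton whose states are the elements of a finite set `S ⊂ ℤ` is
number-conserving if it preserves the sum of the states over a period of every
spatially periodic configuration. -/
def NumberConserving {S : Finset ℤ} (F : CellularAutomaton S) : Prop :=
  ∀ (c : ℤ → S) (p : ℕ), 0 < p → (∀ i, c (i + p) = c i) →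
    ∑ k ∈ Finset.range p, (c k : ℤ) = ∑ k ∈ Finset.range p, (F.globalMap c k : ℤ)

end CellularAutomaton

/-! A number-conserving automaton can imitate any automaton: replace each state by a pair of cells
holding a positive code and its opposite. Every pair has sum zero before and after a step, so only
the existence of some intrinsically universal automaton is needed.

That automaton has three superposed tapes: fixed data, heads moving right, instructions moving left.
An instruction is an arbitrary self-map of the finite set of (head, datum) pairs, so the transition
table of the simulated automaton lies in the configuration and the state set does not depend on it.
By gathering neighbors (`exists_pairRuleMap_blockSimulates`) the simulated rule may be taken of the
form `f (c i) (c (i + 1))`. Each block holds a state in one-hot form. One head for each pair of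
states compares two consecutive blocks with its pair and, on a match, writes the value of `f` in the
third (`instr_headState_dataState`); a first, separate head has erased the old datum there.

The three simulations are composed by `BlockSimulates.trans`, and `BlockSimulates.simulates` turns
the result into a rescaling. -/

namespace CellularAutomaton

/-! ### Local maps as global maps of automata -/

section Local

@[simp] lemma shift_apply {S : Type u} (k : ℤ) (c : ℤ → S) (i : ℤ) : shift k c i = c (i + k) := rfl

lemma shift_zero {S : Type u} (c : ℤ → S) : shift 0 c = c := by
  funext i; simp

lemma shift_shift {S : Type u} (k l : ℤ) (c : ℤ → S) : shift k (shift l c) = shift (k + l) c := by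
  funext i; simp [add_assoc]

/-- A map of configurations that commutes with shifts and whose value at the origin depends
only on finitely many cells. -/
structure IsLocal {S : Type u} {T : Type v} (Ψ : (ℤ → S) → (ℤ → T)) : Prop where
  map_shift : ∀ k c, Ψ (shift k c) = shift k (Ψ c)
  finite_range : ∃ R : ℕ, ∀ c c' : ℤ → S, (∀ i : ℤ, |i| ≤ R → c i = c' i) → Ψ c 0 = Ψ c' 0

lemma IsLocal.apply_eq {S : Type u} {T : Type v} {Ψ : (ℤ → S) → (ℤ → T)} (h : IsLocal Ψ)
    (c : ℤ → S) (i : ℤ) : Ψ c i = Ψ (shift i c) 0 := by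
  rw [h.map_shift]; simp

lemma IsLocal.finite_range_on {S : Type u} {T : Type v} {Ψ : (ℤ → S) → (ℤ → T)}
    (h : IsLocal Ψ) (M : ℕ) : ∃ R : ℕ, ∀ c c' : ℤ → S, (∀ i : ℤ, |i| ≤ R → c i = c' i) →
      ∀ i : ℤ, |i| ≤ M → Ψ c i = Ψ c' i := by
  obtain ⟨R, hR⟩ := h.finite_range
  refine ⟨R + M, fun c c' hc i hi => ?_⟩
  rw [h.apply_eq c, h.apply_eq c']
  refine hR _ _ fun l hl => hc _ ?_
  push_cast
  exact (abs_add_le l i).trans (add_le_add hl hi)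

lemma IsLocal.iterate {S : Type u} {Ψ : (ℤ → S) → (ℤ → S)} (h : IsLocal Ψ) (n : ℕ) :
    IsLocal Ψ^[n] := by
  induction n with
  | zero => exact ⟨fun _ _ => rfl, 0, fun c c' hc => hc 0 (by simp)⟩
  | succ n ih =>
    refine ⟨fun k c => by simp only [Function.iterate_succ_apply, h.map_shift, ih.map_shift], ?_⟩
    obtain ⟨R, hR⟩ := ih.finite_range
    obtain ⟨R', hR'⟩ := h.finite_range_on R
    exact ⟨R', fun c c' hc => hR _ _ (hR' c c' hc)⟩

lemma isLocal_globalMap {S : Type u} [Finite S] (F : CellularAutomaton S) :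
    IsLocal F.globalMap := by
  refine ⟨fun k c => ?_, ?_⟩
  · funext i
    simp only [globalMap, shift_apply]
    congr 1; funext j; congr 1; ring
  · refine ⟨F.nbhd.sup Int.natAbs, fun c c' hc => ?_⟩
    simp only [globalMap]
    congr 1; funext j
    apply hc
    have := Finset.le_sup (f := Int.natAbs) j.2
    rw [abs_le]
    omega

/-- Every local map is the global map of a cellular automaton. -/
lemma IsLocal.exists_globalMap_eq {S : Type u} [Finite S] [Nonempty S]
    {Ψ : (ℤ → S) → (ℤ → S)} (h : IsLocal Ψ) :
    ∃ F : CellularAutomaton S, F.globalMap = Ψ := by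
  classical
  obtain ⟨R, hR⟩ := h.finite_range
  obtain ⟨s⟩ := ‹Nonempty S›
  refine ⟨⟨Finset.Icc (-R : ℤ) R, fun v =>
    Ψ (fun i => if hi : i ∈ Finset.Icc (-R : ℤ) R then v ⟨i, hi⟩ else s) 0⟩, ?_⟩
  funext c i
  rw [h.apply_eq c i]
  simp only [globalMap]
  refine hR _ _ fun l hl => ?_
  have : l ∈ Finset.Icc (-R : ℤ) R := by rw [Finset.mem_Icc]; exact abs_le.mp hl
  simp [this, add_comm]

end Local

/-! ### Existence of rescalings -/

section Rescaling

lemma pack_symm_shift {S : Type u} (m : ℕ) [NeZero m] (k : ℤ) (d : ℤ → Fin m → S) :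
    (pack m).symm (shift k d) = shift (m * k) ((pack m).symm d) := by
  rw [Equiv.symm_apply_eq]
  funext i r
  have := congrFun (congrFun ((pack m).apply_symm_apply d) (i + k)) r
  simp only [pack, Equiv.coe_fn_mk, shift_apply] at this ⊢
  rw [← this, mul_add, add_right_comm]

lemma pack_shift {S : Type u} (m : ℕ) [NeZero m] (k : ℤ) (c : ℤ → S) :
    pack m (shift (m * k) c) = shift k (pack m c) := by
  rw [← Equiv.eq_symm_apply, pack_symm_shift, Equiv.symm_apply_apply]

lemma isLocal_rescaling {S : Type u} {Ψ : (ℤ → S) → (ℤ → S)} (h : IsLocal Ψ) (m : ℕ) [NeZero m]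
    (k : ℤ) : IsLocal fun c : ℤ → (Fin m → S) => shift k (pack m (Ψ ((pack m).symm c))) := by
  refine ⟨fun l c => ?_, ?_⟩
  · rw [pack_symm_shift, h.map_shift, pack_shift, shift_shift, shift_shift, add_comm]
  -- After the shift by `k`, the cell at the origin is the block `m * k + r` with `r < m`, which
  -- this radius covers.
  · obtain ⟨R, hR⟩ := h.finite_range_on (m * k.natAbs + m)
    refine ⟨R, fun c c' hc => funext fun r => ?_⟩
    refine hR _ _ (fun i hi => ?_) _ ?_
    · have : c (i / m) = c' (i / m) := hc _ (by
        rw [abs_le] at hi ⊢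
        have hm : (0 : ℤ) < m := by exact_mod_cast NeZero.pos m
        constructor
        · rw [Int.le_ediv_iff_mul_le hm]; nlinarith
        · exact Int.ediv_le_of_le_mul hm (by nlinarith))
      exact congrFun this _
    · have h1 := r.2
      have h2 : |(m : ℤ) * k| = m * k.natAbs := by rw [abs_mul]; simp
      have h3 : |((r : ℕ) : ℤ)| ≤ m := by rw [Nat.abs_cast]; exact_mod_cast h1.le
      rw [zero_add]
      push_cast at h2 ⊢
      exact (abs_add_le _ _).trans (by rw [h2]; gcongr)

lemma exists_isRescaling {S : Type u} [Finite S] [Nonempty S] (F : CellularAutomaton S) (m : ℕ)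
    [NeZero m] (n : ℕ) (k : ℤ) : ∃ H : CellularAutomaton (Fin m → S), F.IsRescaling m n k H := by
  obtain ⟨H, hH⟩ :=
    (isLocal_rescaling ((isLocal_globalMap F).iterate n) m k).exists_globalMap_eq
  exact ⟨H, fun c => congrFun hH c⟩

end Rescaling

/-! ### Block simulation and its transitivity -/

section BlockSimulation

/-- An injective map of configurations replacing each cell by a block of `m` cells determined
by the state of that cell. -/
structure IsBlockCode {T : Type v} {S : Type u} (m : ℕ) (Φ : (ℤ → T) → (ℤ → S)) : Prop where
  pos : 0 < m
  injective : Function.Injective Φ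
  map_shift : ∀ k c, Φ (shift k c) = shift (m * k) (Φ c)
  congr : ∀ c c' i, c i = c' i → ∀ r : ℤ, 0 ≤ r → r < m → Φ c (m * i + r) = Φ c' (m * i + r)

/-- Some iterate of `F` acts on block-coded configurations as a shift of `G`. -/
def BlockSimulates {S : Type u} {T : Type v} (F : (ℤ → S) → (ℤ → S)) (G : (ℤ → T) → (ℤ → T))
    (m : ℕ) (k : ℤ) : Prop :=
  ∃ (n : ℕ) (Φ : (ℤ → T) → (ℤ → S)), 0 < n ∧ IsBlockCode m Φ ∧
    ∀ c, F^[n] (Φ c) = Φ (shift k (G c))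

lemma IsBlockCode.comp {S T V : Type*} {m m' : ℕ} {Φ : (ℤ → T) → (ℤ → S)}
    {Φ' : (ℤ → V) → (ℤ → T)} (h : IsBlockCode m Φ) (h' : IsBlockCode m' Φ') :
    IsBlockCode (m * m') (Φ ∘ Φ') := by
  refine ⟨Nat.mul_pos h.pos h'.pos, h.injective.comp h'.injective, fun k c => ?_, ?_⟩
  · simp only [Function.comp_apply, h'.map_shift, h.map_shift]
    congr 1; push_cast; ring
  · intro c c' i hi r hr hr'
    have hm : (0 : ℤ) < m := by exact_mod_cast h.pos
    have e : ((m * m' : ℕ) : ℤ) * i + r = m * (m' * i + r / m) + r % m := by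
      have := Int.mul_ediv_add_emod r m
      push_cast; linear_combination -this
    rw [e]
    refine h.congr _ _ _ (h'.congr _ _ _ hi _ (Int.ediv_nonneg hr hm.le) ?_) _
      (Int.emod_nonneg _ hm.ne') (Int.emod_lt_of_pos _ hm)
    apply Int.ediv_lt_of_lt_mul hm
    push_cast at hr'; linarith

/-- The drift of the first simulation must be a multiple of `m'`: only then is it a shift by whole
blocks of the second code, which passes through `Φ'`. -/
lemma BlockSimulates.trans {S T V : Type*} {F : (ℤ → S) → (ℤ → S)} {G : (ℤ → T) → (ℤ → T)}
    {H : (ℤ → V) → (ℤ → V)} {m m' : ℕ} {k k' : ℤ} (hG : ∀ k c, G (shift k c) = shift k (G c))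
    (h : BlockSimulates F G m (m' * k)) (h' : BlockSimulates G H m' k') :
    ∃ l, BlockSimulates F H (m * m') l := by
  obtain ⟨n, Φ, hn, hΦ, hFG⟩ := h
  obtain ⟨n', Φ', hn', hΦ', hGH⟩ := h'
  refine ⟨n' * k + k', n * n', Φ ∘ Φ', Nat.mul_pos hn hn', hΦ.comp hΦ', fun c => ?_⟩
  have key : ∀ (p : ℕ) d, (F^[n])^[p] (Φ d) = Φ (shift (m' * (p * k)) (G^[p] d)) := by
    intro p
    induction p with
    | zero => intro d; simp [shift_zero]
    | succ p ih =>
      intro d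
      rw [Function.iterate_succ_apply', ih, hFG, hG, shift_shift, Function.iterate_succ_apply']
      congr 2; push_cast; ring
  rw [Function.iterate_mul, Function.comp_apply, Function.comp_apply, key, hGH, ← hΦ'.map_shift,
    shift_shift]

/-- Rescaling with shift `-k` cancels the drift; a state is embedded as the block coding it, read
off a constant configuration. -/
lemma BlockSimulates.simulates {S : Type u} {T : Type v} [Finite S] [Finite T] [Nonempty S]
    {F : CellularAutomaton S} {G : CellularAutomaton T} {m : ℕ} {k : ℤ}
    (h : BlockSimulates F.globalMap G.globalMap m k) : F.Simulates G := by
  obtain ⟨n, Φ, hn, hΦ, hFG⟩ := h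
  have hm : NeZero m := ⟨hΦ.pos.ne'⟩
  obtain ⟨H, hH⟩ := exists_isRescaling F m n (-k)
  refine ⟨m, hm, n, -k, H, hn, hH, fun q r => Φ (fun _ => q) (r : ℕ), ?_, ?_⟩
  · intro q q' hq
    -- The code of a constant configuration is `m`-periodic, so a single block determines it.
    have key : ∀ q i, Φ (fun _ => q) i = Φ (fun _ => q) (i % m) := by
      intro q i
      have := congrFun (hΦ.map_shift (i / m) (fun _ => q)) (i % m)
      rw [shift_apply, Int.emod_add_mul_ediv] at this
      exact this.symm
    have : Φ (fun _ => q) = Φ (fun _ => q') := by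
      funext i
      have hm' : (0 : ℤ) < m := by exact_mod_cast hΦ.pos
      rw [key, key q']
      obtain ⟨r, hr⟩ := Int.eq_ofNat_of_zero_le (Int.emod_nonneg i hm'.ne')
      have hlt := Int.emod_lt_of_pos i hm'
      rw [hr] at hlt ⊢
      exact congrFun hq ⟨r, by exact_mod_cast hlt⟩
    exact congrFun (hΦ.injective this) 0
  · have key : ∀ c : ℤ → T, (fun q (r : Fin m) => Φ (fun _ => q) (r : ℕ)) ∘ c = pack m (Φ c) := by
      intro c
      funext i r
      have h1 := hΦ.congr c (fun _ => c i) i rfl (r : ℕ) (by positivity) (by exact_mod_cast r.2)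
      have h2 := congrFun (hΦ.map_shift i (fun _ => c i)) (r : ℕ)
      rw [shift_apply, add_comm, ← h1] at h2
      exact h2
    intro c
    rw [hH, key, key, Equiv.symm_apply_apply, hFG, ← pack_shift, ← hΦ.map_shift, shift_shift,
      neg_add_cancel, shift_zero]

end BlockSimulation

/-! ### Number-conserving simulation by opposite pairs -/

section NumberConserving

variable {Q : Type u} [Finite Q]

/-- A positive integer code of the elements of a finite type. -/
noncomputable def posCode (q : Q) : ℤ := (Finite.equivFin Q q : ℕ) + 1

lemma posCode_pos (q : Q) : 0 < posCode q := by unfold posCode; positivity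

lemma posCode_injective : Function.Injective (posCode : Q → ℤ) := by
  intro q q' h
  simp only [posCode, add_left_inj, Nat.cast_inj] at h
  exact (Finite.equivFin Q).injective (Fin.ext h)

variable (Q) in
/-- The codes of the elements of `Q` and their opposites. -/
noncomputable def signedCodes : Finset ℤ :=
  letI := Fintype.ofFinite Q
  Finset.univ.image (posCode : Q → ℤ) ∪ Finset.univ.image fun q : Q => -posCode q

noncomputable def posState (q : Q) : signedCodes Q :=
  ⟨posCode q, by simp [signedCodes]⟩

noncomputable def negState (q : Q) : signedCodes Q :=
  ⟨-posCode q, by simp [signedCodes]⟩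

lemma posState_injective : Function.Injective (posState : Q → signedCodes Q) := fun _ _ h =>
  posCode_injective (congrArg Subtype.val h)

lemma posState_ne_negState (q q' : Q) : posState q ≠ negState q' := fun h => by
  have h1 : posCode q = -posCode q' := congrArg Subtype.val h
  have := posCode_pos q
  have := posCode_pos q'
  omega

/-- The cells `i + 2j, i + 2j + 1` hold opposite codes for every `j` in the neighborhood of `F`
and for `j = 0`. -/
def IsPaired (F : CellularAutomaton Q) (c : ℤ → signedCodes Q) (i : ℤ) : Prop :=
  ∀ j ∈ insert 0 F.nbhd, ∃ q : Q, c (i + 2 * j) = posState q ∧ c (i + 2 * j + 1) = negState q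

lemma IsPaired.exists_zero {F : CellularAutomaton Q} {c : ℤ → signedCodes Q} {i : ℤ}
    (h : IsPaired F c i) : ∃ q : Q, c i = posState q ∧ c (i + 1) = negState q := by
  simpa using h 0 (by simp)

/-- Pairs cannot overlap, because no state is both a positive and a negative code; hence the two
active cases of `pairMap` never compete for a cell. -/
lemma IsPaired.not_succ {F : CellularAutomaton Q} {c : ℤ → signedCodes Q} {i : ℤ}
    (h : IsPaired F c i) : ¬ IsPaired F c (i + 1) := fun h' => by
  obtain ⟨q, -, hq⟩ := h.exists_zero
  obtain ⟨q', hq', -⟩ := h'.exists_zero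
  exact posState_ne_negState q' q (hq'.symm.trans hq)

lemma isPaired_shift (F : CellularAutomaton Q) (c : ℤ → signedCodes Q) (k i : ℤ) :
    IsPaired F (shift k c) i ↔ IsPaired F c (i + k) := by
  simp only [IsPaired, shift_apply]
  have e1 : ∀ j : ℤ, i + 2 * j + k = i + k + 2 * j := fun j => by ring
  have e2 : ∀ j : ℤ, i + 2 * j + 1 + k = i + k + 2 * j + 1 := fun j => by ring
  simp only [e1, e2]

/-- Write the code of each state followed by its opposite. -/
noncomputable def pairCode (d : ℤ → Q) : ℤ → signedCodes Q := fun i =>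
  if i % 2 = 0 then posState (d (i / 2)) else negState (d (i / 2))

lemma pairCode_even (d : ℤ → Q) (i : ℤ) : pairCode d (2 * i) = posState (d i) := by
  simp [pairCode]

lemma pairCode_odd (d : ℤ → Q) (i : ℤ) : pairCode d (2 * i + 1) = negState (d i) := by
  have h1 : (2 * i + 1) % 2 = 1 := by omega
  have h2 : (2 * i + 1) / 2 = i := by omega
  simp [pairCode, h1, h2]

lemma isBlockCode_pairCode : IsBlockCode 2 (pairCode : (ℤ → Q) → _) := by
  refine ⟨by norm_num, fun d d' h => funext fun i => ?_, fun k d => funext fun i => ?_, ?_⟩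
  · apply posState_injective
    rw [← pairCode_even, ← pairCode_even, h]
  · have h1 : (i + 2 * k) % 2 = i % 2 := by omega
    have h2 : (i + 2 * k) / 2 = i / 2 + k := by omega
    simp [pairCode, h1, h2]
  · intro c c' i h r hr hr'
    have : (2 * i + r) / 2 = i := by push_cast at hr'; omega
    simp [pairCode, this, h]

variable [Nonempty Q]

/-- The result of `F` on the states coded at `i + 2j`, for `j` in the neighborhood. -/
noncomputable def pairedValue (F : CellularAutomaton Q) (c : ℤ → signedCodes Q) (i : ℤ) : Q :=
  F.rule fun j => Function.invFun posState (c (i + 2 * (j : ℤ)))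

lemma pairedValue_shift (F : CellularAutomaton Q) (c : ℤ → signedCodes Q) (k i : ℤ) :
    pairedValue F (shift k c) i = pairedValue F c (i + k) := by
  simp only [pairedValue, shift_apply]
  have e1 : ∀ j : ℤ, i + 2 * j + k = i + k + 2 * j := fun j => by ring
  simp only [e1]

open Classical in
/-- Apply `F` to pairs of cells holding opposite codes, leaving other cells unchanged. -/
noncomputable def pairMap (F : CellularAutomaton Q) (c : ℤ → signedCodes Q) :
    ℤ → signedCodes Q := fun i =>
  if IsPaired F c i then posState (pairedValue F c i)
  else if IsPaired F c (i - 1) then negState (pairedValue F c (i - 1))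
  else c i

lemma isLocal_pairMap (F : CellularAutomaton Q) : IsLocal (pairMap F) := by
  classical
  refine ⟨fun k c => ?_, ?_⟩
  · funext i
    simp only [pairMap, shift_apply, isPaired_shift, pairedValue_shift, sub_add_eq_add_sub]
  · refine ⟨2 * F.nbhd.sup Int.natAbs + 3, fun c c' hc => ?_⟩
    have hj : ∀ j ∈ F.nbhd, j.natAbs ≤ F.nbhd.sup Int.natAbs := fun j hj =>
      Finset.le_sup (f := Int.natAbs) hj
    have hj' : ∀ j ∈ insert 0 F.nbhd, j.natAbs ≤ F.nbhd.sup Int.natAbs := by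
      intro j h
      rcases Finset.mem_insert.mp h with rfl | h
      · simp
      · exact hj j h
    have h1 : ∀ i : ℤ, -1 ≤ i → i ≤ 0 → (IsPaired F c i ↔ IsPaired F c' i) := by
      intro i hi hi'
      refine forall₂_congr fun j h => ?_
      have := hj' j h
      rw [hc (i + 2 * j) (by rw [abs_le]; push_cast; omega),
        hc (i + 2 * j + 1) (by rw [abs_le]; push_cast; omega)]
    have h2 : ∀ i : ℤ, -1 ≤ i → i ≤ 0 → pairedValue F c i = pairedValue F c' i := by
      intro i hi hi'
      unfold pairedValue
      congr 1; funext j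
      have := hj j j.2
      rw [hc (i + 2 * j) (by rw [abs_le]; push_cast; omega)]
    simp only [pairMap]
    rw [hc 0 (by simp; positivity)]
    simp only [h1 0 (by simp) le_rfl, h1 (0 - 1) (by simp) (by simp), h2 0 (by simp) le_rfl,
      h2 (0 - 1) (by simp) (by simp)]

/-- What the left cell of a pair gains, the right cell loses. The change is thus a discrete
derivative `g i - g (i - 1)`, whose sum over a period telescopes to zero. -/
lemma sum_pairMap (F : CellularAutomaton Q) (c : ℤ → signedCodes Q) (p : ℕ)
    (hp : ∀ i, c (i + p) = c i) :
    ∑ k ∈ Finset.range p, (c k : ℤ) = ∑ k ∈ Finset.range p, (pairMap F c k : ℤ) := by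
  classical
  set g : ℤ → ℤ := fun i => if IsPaired F c i then posCode (pairedValue F c i) - c i else 0
    with hg
  have hstep : ∀ i, (pairMap F c i : ℤ) = c i + (g i - g (i - 1)) := by
    intro i
    simp only [hg, pairMap]
    by_cases h0 : IsPaired F c i
    · have h1 : ¬ IsPaired F c (i - 1) := fun h => h.not_succ (by simpa using h0)
      simp [h0, h1, posState]
    · by_cases h1 : IsPaired F c (i - 1)
      · obtain ⟨q, hq, hq'⟩ := h1.exists_zero
        rw [sub_add_cancel] at hq'
        simp [h0, h1, hq, hq', posState, negState]
        ring
      · simp [h0, h1]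
  have hper : g p = g 0 := by
    have hs : shift p c = c := funext hp
    have h1 := isPaired_shift F c p 0
    have h2 := pairedValue_shift F c p 0
    rw [hs, zero_add] at h1 h2
    have h3 := hp 0
    rw [zero_add] at h3
    simp only [hg, ← h1, ← h2, h3]
  have hper' : g (p - 1) = g (0 - 1) := by
    have hs : shift p c = c := funext hp
    have h1 := isPaired_shift F c p (-1)
    have h2 := pairedValue_shift F c p (-1)
    have e : (-1 : ℤ) + p = p - 1 := by ring
    rw [hs, e] at h1 h2
    have h3 := hp (-1)
    rw [e] at h3
    simp only [hg, zero_sub, ← h1, ← h2, h3]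
  have htel := Finset.sum_range_sub (fun k : ℕ => g ((k : ℤ) - 1)) p
  simp only [Nat.cast_add, Nat.cast_one, add_sub_cancel_right, Nat.cast_zero] at htel
  simp only [hstep, Finset.sum_add_distrib, htel, hper', sub_self, add_zero]

lemma pairMap_pairCode (F : CellularAutomaton Q) (d : ℤ → Q) :
    pairMap F (pairCode d) = pairCode (F.globalMap d) := by
  have hp : ∀ i, IsPaired F (pairCode d) (2 * i) := fun i j _ =>
    ⟨d (i + j), by rw [← mul_add, pairCode_even], by rw [← mul_add, pairCode_odd]⟩
  have hv : ∀ i, pairedValue F (pairCode d) (2 * i) = F.globalMap d i := by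
    intro i
    simp only [pairedValue, globalMap, ← mul_add, pairCode_even,
      Function.leftInverse_invFun posState_injective _]
  funext i
  obtain ⟨k, rfl | rfl⟩ := Int.even_or_odd' i
  · rw [pairCode_even]
    simp [pairMap, hp, hv]
  · rw [pairCode_odd]
    simp [pairMap, hp, hv, (hp k).not_succ]

/-- Every cellular automaton is simulated by a number-conserving one. -/
lemma exists_numberConserving_blockSimulates (F : CellularAutomaton Q) :
    ∃ N : CellularAutomaton (signedCodes Q), N.NumberConserving ∧
      BlockSimulates N.globalMap F.globalMap 2 0 := by
  have : Nonempty (signedCodes Q) := ‹Nonempty Q›.map posState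
  obtain ⟨N, hN⟩ := (isLocal_pairMap F).exists_globalMap_eq
  refine ⟨N, fun c p _ hp => ?_, 1, pairCode, one_pos, isBlockCode_pairCode, fun c => ?_⟩
  · rw [hN]; exact sum_pairMap F c p hp
  · rw [hN, shift_zero, Function.iterate_one, pairMap_pairCode]

end NumberConserving

/-! ### Reduction to the neighborhood {0, 1} -/

section Gather

variable {T : Type v}

/-- One step of a two-cell automaton which collects the states of `w + 1` consecutive cells
and then applies `f` to them. -/
def gatherRule {w : ℕ} (f : (Fin (w + 1) → T) → T) (a b : Fin (w + 1) × (Fin (w + 1) → T)) :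
    Fin (w + 1) × (Fin (w + 1) → T) :=
  if a.1 = Fin.last w then (0, fun _ => f a.2)
  else (a.1 + 1, fun i => if i = 0 then a.2 0 else b.2 (i - 1))

/-- The global map of the automaton with neighborhood `{0, 1}` and local rule `f`. -/
def pairRuleMap (f : T → T → T) (c : ℤ → T) : ℤ → T := fun i => f (c i) (c (i + 1))

/-- Each step prepends a cell's own state to the right neighbor's list, so after `l` steps the
entries up to `l` are correct and the later ones repeat the entry `l`. -/
lemma pairRuleMap_gatherRule_iterate {w : ℕ} (f : (Fin (w + 1) → T) → T) (c : ℤ → T) (l : ℕ)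
    (hl : l ≤ w) : (pairRuleMap (gatherRule f))^[l] (fun i => (0, fun _ => c i)) =
      fun i => (Fin.ofNat (w + 1) l, fun r : Fin (w + 1) => c (i + (min (r : ℕ) l : ℕ))) := by
  induction l with
  | zero => funext i; simp
  | succ l ih =>
    rw [Function.iterate_succ_apply', ih (by omega)]
    funext i
    have h1 : Fin.ofNat (w + 1) l ≠ Fin.last w := fun h => by
      have := congrArg Fin.val h
      simp [Nat.mod_eq_of_lt (show l < w + 1 by omega)] at this
      omega
    simp only [pairRuleMap, gatherRule, h1, if_false]
    refine Prod.ext ?_ (funext fun r => ?_)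
    · apply Fin.ext
      simp [Fin.val_add]
    · rcases Fin.eq_zero_or_eq_succ r with rfl | ⟨r, rfl⟩
      · simp
      · have : ((r.succ - 1 : Fin (w + 1)) : ℕ) = r := by
          rw [Fin.coe_sub_one]; simp
        simp only [Fin.succ_ne_zero, if_false, this, Fin.val_succ]
        congr 1
        push_cast
        omega

lemma exists_pairRuleMap_blockSimulates [Finite T] (G : CellularAutomaton T) :
    ∃ (w : ℕ) (f : Fin (w + 1) × (Fin (w + 1) → T) → Fin (w + 1) × (Fin (w + 1) → T) →
      Fin (w + 1) × (Fin (w + 1) → T)) (k : ℤ),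
      BlockSimulates (pairRuleMap f) G.globalMap 1 k := by
  set r := G.nbhd.sup Int.natAbs with hr
  have hj : ∀ j : G.nbhd, (((j : ℤ) + r).toNat : ℤ) = j + r ∧ ((j : ℤ) + r).toNat < 2 * r + 1 := by
    intro j
    have := Finset.le_sup (f := Int.natAbs) j.2
    omega
  -- The window `[i, i + 2r]` gathered at `i` is the neighborhood of `i + r`, hence the drift `r`;
  -- `2r` steps gather and one applies the rule.
  refine ⟨2 * r, gatherRule fun v => G.rule fun j => v ⟨_, (hj j).2⟩, r, 2 * r + 1,
    fun c i => (0, fun _ => c i), by omega, ⟨one_pos, fun c c' h => funext fun i => ?_,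
      fun k c => funext fun i => ?_, fun c c' i h s hs hs' => ?_⟩, fun c => ?_⟩
  · exact congrFun (congrArg Prod.snd (congrFun h i)) 0
  · simp
  · obtain rfl : s = 0 := by push_cast at hs'; omega
    simp [h]
  · rw [Function.iterate_succ_apply', pairRuleMap_gatherRule_iterate _ _ _ le_rfl]
    funext i
    have h1 : Fin.ofNat (2 * r + 1) (2 * r) = Fin.last (2 * r) := by
      apply Fin.ext; simp
    simp only [pairRuleMap, gatherRule, h1, if_true, shift_apply, globalMap]
    refine Prod.ext rfl (funext fun _ => congrArg G.rule (funext fun j => congrArg c ?_))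
    have := hj j
    push_cast
    omega

end Gather

/-! ### The universal three-tape automaton -/

section Tape

variable {A B : Type}

/-- A cell of three superposed tapes: a static tape of data, a tape of heads moving to the right,
and a tape of instructions moving to the left. -/
abbrev TapeCell (A B : Type) : Type := Option B × Option A × (A × B → A × B)

/-- The instruction acts on the datum and the head when both are present. -/
def meet (x : TapeCell A B) : Option B × Option A :=
  match x with
  | (some b, some a, p) => (some (p (a, b)).2, some (p (a, b)).1)
  | (b, a, _) => (b, a)

lemma meet_some (a : A) (b : B) (p : A × B → A × B) :
    meet (some b, some a, p) = (some (p (a, b)).2, some (p (a, b)).1) := rfl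

lemma meet_none_left (a : Option A) (p : A × B → A × B) : meet (none, a, p) = (none, a) := by
  cases a <;> rfl

lemma meet_none_right (b : Option B) (p : A × B → A × B) : meet (b, none, p) = (b, none) := by
  cases b <;> rfl

/-- Heads and instructions approach each other at speed 2: the head from `h` uses in cell `i` the
instruction that started at `2 * i - h`. Consecutive cells thus consume every second instruction. -/
def tapeMap (c : ℤ → TapeCell A B) : ℤ → TapeCell A B := fun i =>
  ((meet (c i)).1, (meet (c (i - 1))).2, (c (i + 1)).2.2)

lemma isLocal_tapeMap : IsLocal (tapeMap (A := A) (B := B)) := by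
  refine ⟨fun k c => funext fun i => ?_, 1, fun c c' h => ?_⟩
  · simp only [tapeMap, shift_apply, sub_add_eq_add_sub, add_right_comm]
  · simp only [tapeMap]
    rw [h 0 (by simp), h (0 - 1) (by simp), h (0 + 1) (by simp)]

/-- The evolution of the tapes is determined by any assignment `a h i`, `b h i` of the states of
the head starting at `h` and of the datum at `i` just before they meet. -/
lemma tapeMap_iterate (p : ℤ → A × B → A × B) (a : ℤ → ℤ → Option A) (b : ℤ → ℤ → Option B)
    (n : ℕ) (h : ∀ l i : ℤ, l ≤ i → i < l + n →
      meet (b l i, a l i, p (2 * i - l)) = (b (l - 1) i, a l (i + 1))) (t : ℕ) (ht : t ≤ n) :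
    tapeMap^[t] (fun i => (b i i, a i i, p i)) =
      fun i => (b (i - t) i, a (i - t) i, p (i + t)) := by
  induction t with
  | zero => funext i; simp
  | succ t ih =>
    rw [Function.iterate_succ_apply', ih (by omega)]
    funext i
    have h1 := h (i - t) i (by omega) (by omega)
    have h2 := h (i - 1 - t) (i - 1) (by omega) (by omega)
    rw [show 2 * i - (i - t) = i + t by ring] at h1
    rw [show 2 * (i - 1) - (i - 1 - t) = i - 1 + t by ring, sub_add_cancel] at h2
    simp only [tapeMap, h1, h2]
    push_cast
    rw [show i - (t : ℤ) - 1 = i - (t + 1) by ring, show i - 1 - (t : ℤ) = i - (t + 1) by ring,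
      show i + 1 + (t : ℤ) = i + (t + 1) by ring]

end Tape

/-! ### Instructions and their intended effect on a block -/

section Program

lemma posCode_lt {T : Type v} [Finite T] (q : T) : posCode q < Nat.card T + 1 := by
  have := (Finite.equivFin T q).2
  unfold posCode
  omega

variable {T : Type v} [Finite T] [Nonempty T]

/-- The `l`-th pair of states. -/
noncomputable def row (T : Type v) [Finite T] [Nonempty T] (l : ℤ) : T × T :=
  Function.invFun posCode l

lemma row_posCode (p : T × T) : row T (posCode p) = p :=
  Function.leftInverse_invFun posCode_injective p

/-- Head states consist of a phase and a bit. In phase `0` the head loads a bit, in phase `1` it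
takes the conjunction with another one, in phase `2` it adds the result to the data; the phase
changes at the offset `s`. Instructions for `l = 0` erase the data in phase `2`. -/
noncomputable def instr (f : T → T → T) (s l o : ℤ) :
    (Fin 3 × Bool) × Bool → (Fin 3 × Bool) × Bool
  | ((0, y), x) => ((if o = s then 1 else 0, if posCode (row T l).1 = o then x else y), x)
  | ((1, y), x) => ((if o = s then 2 else 1, if posCode (row T l).2 = o then y && x else y), x)
  | ((2, y), x) => ((if o = s then 0 else 2, if o = s then false else y),
      if l = 0 then false else x || (y && decide (posCode (f (row T l).1 (row T l).2) = o)))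

open Classical in
/-- The state of the `l`-th head in phase `τ` before it reads the offset `o` of the block `j`. -/
noncomputable def headState (c : ℤ → T) (j τ l o : ℤ) : Fin 3 × Bool :=
  if τ = 0 then (0, decide (posCode (row T l).1 < o ∧ c j = (row T l).1))
  else if τ = 1 then
    (1, decide (c (j - 1) = (row T l).1 ∧ (posCode (row T l).2 < o → c j = (row T l).2)))
  else if τ = 2 then (2, decide (c (j - 2) = (row T l).1 ∧ c (j - 1) = (row T l).2))
  else (0, false)

open Classical in
/-- The datum at offset `o` of the block `j` after the passage of `κ` heads, out of `L` for each
phase. -/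
noncomputable def dataState (f : T → T → T) (L : ℤ) (c : ℤ → T) (j o κ : ℤ) : Bool :=
  if κ ≤ 2 * L then decide (posCode (c j) = o)
  else decide (posCode (f (c (j - 2)) (c (j - 1))) = o ∧
    ∃ l, 1 ≤ l ∧ l < κ - 2 * L ∧ row T l = (c (j - 2), c (j - 1)))

lemma instr_two_snd (f : T → T → T) (s l o : ℤ) (x y : Bool) :
    (instr f s l o ((2, y), x)).2 = if l = 0 then false else
      (x || (y && decide (posCode (f (row T l).1 (row T l).2) = o))) := rfl

open Classical in
lemma headState_two (c : ℤ → T) (j l o : ℤ) : headState c j 2 l o =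
    (2, decide (c (j - 2) = (row T l).1 ∧ c (j - 1) = (row T l).2)) := by
  simp [headState]

lemma dataState_eq_true_of_le (f : T → T → T) {L : ℤ} (c : ℤ → T) (j o : ℤ) {κ : ℤ}
    (h : κ ≤ 2 * L) : dataState f L c j o κ = true ↔ posCode (c j) = o := by
  simp [dataState, h]

lemma dataState_eq_true_of_lt (f : T → T → T) {L : ℤ} (c : ℤ → T) (j o : ℤ) {κ : ℤ}
    (h : 2 * L < κ) : dataState f L c j o κ = true ↔
      posCode (f (c (j - 2)) (c (j - 1))) = o ∧
        ∃ l, 1 ≤ l ∧ l < κ - 2 * L ∧ row T l = (c (j - 2), c (j - 1)) := by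
  simp [dataState, h.not_ge]

lemma dataState_congr (f : T → T → T) {L : ℤ} (c : ℤ → T) (j o : ℤ) {κ κ' : ℤ}
    (h : κ ≤ 2 * L) (h' : κ' ≤ 2 * L) : dataState f L c j o κ = dataState f L c j o κ' := by
  rw [Bool.eq_iff_iff, dataState_eq_true_of_le f c j o h, dataState_eq_true_of_le f c j o h']

/-- One head reading one offset: the explicit formulas for head and datum are consistent with the
instructions. Since `L * τ + l` heads precede this one in the block, the phase of the head and the
age of the block determine each other. -/
lemma instr_headState_dataState (f : T → T → T) {s L : ℤ} (hs : s = Nat.card T + 1)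
    (c : ℤ → T) (j τ l o : ℤ) (hτ : 0 ≤ τ) (hτ' : τ < 3) (hl : 0 ≤ l) (hl' : l < L)
    (ho : 0 ≤ o) :
    instr f s l o (headState c j τ l o, dataState f L c j o (L * τ + l)) =
      (if o = s then headState c (j + 1) (τ + 1) l 0 else headState c j τ l (o + 1),
        dataState f L c j o (L * τ + l + 1)) := by
  have hlt : ∀ q : T, posCode q < s := fun q => hs ▸ posCode_lt q
  have hpos : ∀ q : T, 0 < posCode q := posCode_pos
  have hinj : ∀ q q' : T, posCode q = posCode q' ↔ q = q' := fun q q' =>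
    posCode_injective.eq_iff
  have h3 : τ = 0 ∨ τ = 1 ∨ τ = 2 := by omega
  rcases h3 with rfl | rfl | rfl
  · rw [dataState_congr f c j o (show L * 0 + l + 1 ≤ 2 * L by omega)
      (show L * 0 + l ≤ 2 * L by omega)]
    have hd := dataState_eq_true_of_le f c j o (show L * 0 + l ≤ 2 * L by omega)
    simp only [headState, instr]
    generalize dataState f L c j o (L * 0 + l) = x at hd ⊢
    generalize row T l = p
    obtain ⟨a, b⟩ := p
    have hb := hpos b
    have ha := hlt a
    rcases eq_or_ne o s with rfl | hos
    -- All codes lie strictly between `0` and `s`: at offset `s` the whole state has been read, and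
    -- at offset `0` of the next block nothing has.
    · simp [ha, ha.ne, hb.not_gt]
    · by_cases hao : posCode a = o
      · subst hao
        simp [hos, hinj] at hd ⊢
        rw [Bool.eq_iff_iff, hd]
        simp
      · have : posCode a < o + 1 ↔ posCode a < o := by omega
        simp [hos, hao, this]
  · rw [dataState_congr f c j o (show L * 1 + l + 1 ≤ 2 * L by omega)
      (show L * 1 + l ≤ 2 * L by omega)]
    have hd := dataState_eq_true_of_le f c j o (show L * 1 + l ≤ 2 * L by omega)
    simp only [headState, instr]
    generalize dataState f L c j o (L * 1 + l) = x at hd ⊢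
    generalize row T l = p
    obtain ⟨a, b⟩ := p
    have hb := hlt b
    have e1 : j + 1 - 2 = j - 1 := by ring
    rcases eq_or_ne o s with rfl | hos
    · simp [hb, hb.ne, e1]
    · by_cases hbo : posCode b = o
      · subst hbo
        simp [hos, hinj] at hd ⊢
        rw [Bool.eq_iff_iff, Bool.and_eq_true, hd]
        simp
      · have : posCode b < o + 1 ↔ posCode b < o := by omega
        simp [hos, hbo, this]
  · refine Prod.ext ?_ ?_
    · rcases eq_or_ne o s with rfl | hos
      · simp [headState, instr]
      · simp [headState, instr, hos]
    · rw [Bool.eq_iff_iff, dataState_eq_true_of_lt f c j o (by omega)]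
      rw [headState_two, instr_two_snd]
      -- The head `l = 0` erases; codes of pairs start at `1`, so it stands for no pair.
      rcases eq_or_ne l 0 with rfl | hl0
      · rw [if_pos rfl]
        refine ⟨fun h => by simp at h, ?_⟩
        rintro ⟨-, l', h, h', -⟩
        omega
      · have hd := dataState_eq_true_of_lt f c j o (show 2 * L < L * 2 + l by omega)
        have h4 : ∀ l', l' < L * 2 + l + 1 - 2 * L ↔ l' < L * 2 + l - 2 * L ∨ l' = l := by
          intro l'; omega
        simp only [hl0, if_false, Bool.or_eq_true, Bool.and_eq_true, decide_eq_true_eq, hd, h4]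
        constructor
        · rintro (⟨h, l', h1, h2, h'⟩ | ⟨⟨h, h'⟩, h''⟩)
          · exact ⟨h, l', h1, Or.inl h2, h'⟩
          · exact ⟨by rw [h, h', h''], l, by omega, Or.inr rfl, by rw [h, h']⟩
        · rintro ⟨h, l', h1, h2 | rfl, h'⟩
          · exact Or.inl ⟨h, l', h1, h2, h'⟩
          · exact Or.inr ⟨by simp [h'], by simpa [h'] using h⟩

end Program

/-! ### Simulation of two-neighbor rules by the tape automaton -/

section Universal

variable {T : Type v} [Finite T] [Nonempty T]

/-- The periodic tape of instructions: those of the `l`-th head at the offset `o` are found at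
`w * l + 2 * o`, with period `w * L`. -/
noncomputable def program (f : T → T → T) (s L w u : ℤ) :
    (Fin 3 × Bool) × Bool → (Fin 3 × Bool) × Bool :=
  instr f s (u / w % L) (u % w / 2)

/-- The state, before it reads the offset `o` of the block `j`, of the head starting
at `w * g`. -/
noncomputable def headBefore (L : ℤ) (c : ℤ → T) (g j o : ℤ) : Fin 3 × Bool :=
  headState c j ((L * j - g) / L) ((L * j - g) % L) o

/-- The state of the head starting at `h` before it reads the cell `i`. -/
noncomputable def headAt (s L w : ℤ) (c : ℤ → T) (h i : ℤ) : Option (Fin 3 × Bool) :=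
  if w ∣ h then
    some (if i % (w * L) ≤ s then headBefore L c (h / w) (i / (w * L)) (i % (w * L))
      else headBefore L c (h / w) (i / (w * L) + 1) 0)
  else none

/-- The datum in the cell `i` before it meets the head starting at `h`. -/
noncomputable def dataAt (f : T → T → T) (s L w : ℤ) (c : ℤ → T) (h i : ℤ) : Option Bool :=
  if i % (w * L) ≤ s then
    some (dataState f L c (i / (w * L)) (i % (w * L)) (L * (i / (w * L)) - h / w))
  else none

lemma mul_add_ediv_emod {m j o : ℤ} (ho : 0 ≤ o) (ho' : o < m) :
    (m * j + o) / m = j ∧ (m * j + o) % m = o := by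
  have hm : 0 < m := by omega
  constructor
  · rw [Int.mul_add_ediv_left _ _ hm.ne', Int.ediv_eq_zero_of_lt ho ho', add_zero]
  · rw [Int.mul_add_emod_self_left, Int.emod_eq_of_lt ho ho']

lemma headBefore_succ {L : ℤ} (hL : 0 < L) (c : ℤ → T) (g j o : ℤ) :
    headBefore L c g (j + 1) o =
      headState c (j + 1) ((L * j - g) / L + 1) ((L * j - g) % L) o := by
  have e : L * (j + 1) - g = L * 1 + (L * j - g) := by ring
  rw [headBefore, e, Int.mul_add_ediv_left _ _ hL.ne', Int.mul_add_emod_self_left, add_comm 1]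

/-- This is the hypothesis of `tapeMap_iterate`. The bounds on `i` keep the head within its three
phases. -/
lemma meet_dataAt_headAt (f : T → T → T) {s L w : ℤ} (hs : s = Nat.card T + 1) (hL : 0 < L)
    (hw : w = 2 * (s + 1)) (c : ℤ → T) (h i : ℤ) (hi : h ≤ i) (hi' : i < h + 3 * (w * L)) :
    meet (dataAt f s L w c h i, headAt s L w c h i, program f s L w (2 * i - h)) =
      (dataAt f s L w c (h - 1) i, headAt s L w c h (i + 1)) := by
  have hs0 : 0 < s := by omega
  have hw0 : 0 < w := by omega
  have hwm : w ≤ w * L := by nlinarith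
  obtain ⟨j, o, ho, ho', rfl⟩ : ∃ j o, 0 ≤ o ∧ o < w * L ∧ i = w * L * j + o :=
    ⟨i / (w * L), i % (w * L), Int.emod_nonneg _ (by omega), Int.emod_lt_of_pos _ (by omega),
      (Int.mul_ediv_add_emod i (w * L)).symm⟩
  obtain ⟨e1, e2⟩ := mul_add_ediv_emod (j := j) ho ho'
  have hsucc : o + 1 < w * L → (w * L * j + o + 1) / (w * L) = j ∧
      (w * L * j + o + 1) % (w * L) = o + 1 := fun hlt => by
    rw [add_assoc]; exact mul_add_ediv_emod (by omega) hlt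
  by_cases hos : o ≤ s
  · obtain ⟨e3, e4⟩ := hsucc (by omega)
    by_cases hh : w ∣ h
    · obtain ⟨g, rfl⟩ := hh
      have e5 : w * g / w = g := Int.mul_ediv_cancel_left _ hw0.ne'
      have e6 : (w * g - 1) / w = g - 1 := by
        rw [show w * g - 1 = w * (g - 1) + (w - 1) by ring]
        exact (mul_add_ediv_emod (by omega) (by omega)).1
      -- The instruction met has row `(L * j - g) % L`, which is `-g` modulo `L` in every block, so
      -- a head always obeys the same row. As `w = 2 * (s + 1)`, the offset `2 * o` stays below `w`.
      have e7 : 2 * (w * L * j + o) - w * g = w * (L * j + (L * j - g)) + 2 * o := by ring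
      obtain ⟨e8, e9⟩ := mul_add_ediv_emod (m := w) (j := L * j + (L * j - g)) (o := 2 * o)
        (by omega) (by omega)
      have e10 : 2 * o / 2 = o := by omega
      have ht : w * L * j + o - w * g = w * (L * j - g) + o := by ring
      have hκ : 0 ≤ L * j - g := by
        by_contra hneg
        have : w * (L * j - g) ≤ w * (-1) := by gcongr; omega
        linarith
      have hκ' : L * j - g < 3 * L := by
        by_contra hneg
        have : w * (3 * L) ≤ w * (L * j - g) := by gcongr; omega
        linarith
      have key := instr_headState_dataState f hs c j ((L * j - g) / L) ((L * j - g) % L) o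
        (Int.ediv_nonneg hκ hL.le) (Int.ediv_lt_of_lt_mul hL hκ') (Int.emod_nonneg _ hL.ne')
        (Int.emod_lt_of_pos _ hL) ho
      rw [Int.mul_ediv_add_emod] at key
      simp only [dataAt, headAt, program, e1, e2, e3, e4, e5, e6, e7, e8, e9, e10, hos,
        Int.mul_add_emod_self_left, if_true, dvd_mul_right, meet_some]
      rw [headBefore, key, show L * j - (g - 1) = L * j - g + 1 by ring, headBefore_succ hL]
      rcases eq_or_ne o s with rfl | hne
      · simp
      · simp [hne, show o + 1 ≤ s by omega, headBefore]
    -- No head starts here, so the number of heads that have passed does not change.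
    · have e5 : (h - 1) / w = h / w := by
        have h1 := Int.mul_ediv_add_emod h w
        have h2 := Int.emod_nonneg h hw0.ne'
        have h3 := Int.emod_lt_of_pos h hw0
        have h4 : h % w ≠ 0 := fun h0 => hh (Int.dvd_of_emod_eq_zero h0)
        rw [show h - 1 = w * (h / w) + (h % w - 1) by linarith]
        exact (mul_add_ediv_emod (by omega) (by omega)).1
      simp only [headAt, hh, if_false, meet_none_right, dataAt, e5]
  · simp only [dataAt, e2, hos, if_false, meet_none_left]
    congr 1
    by_cases hlt : o + 1 < w * L
    · obtain ⟨e3, e4⟩ := hsucc hlt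
      simp only [headAt, e1, e2, e3, e4, hos, show ¬ o + 1 ≤ s by omega, if_false]
    -- From the last cell of a block the head enters offset `0` of the next, in the state it has
    -- kept since offset `s`.
    · have e : w * L * j + o + 1 = w * L * (j + 1) + 0 := by linarith
      obtain ⟨e3, e4⟩ := mul_add_ediv_emod (j := j + 1) (le_refl 0) (show 0 < w * L by omega)
      simp only [headAt, e, e1, e2, e3, e4, hos, hs0.le, if_false, if_true]

/-- The block coding of configurations by the three tapes, with blocks of `w * L` cells. -/
noncomputable def tapeCode (f : T → T → T) (s L w : ℤ) (c : ℤ → T) :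
    ℤ → TapeCell (Fin 3 × Bool) Bool := fun i =>
  (if i % (w * L) ≤ s then some (decide (posCode (c (i / (w * L))) = i % (w * L))) else none,
    if w ∣ i then some (0, false) else none, program f s L w i)

lemma isBlockCode_tapeCode (f : T → T → T) {s L w : ℤ} (hs : s = Nat.card T + 1) (hL : 0 < L)
    (hw : w = 2 * (s + 1)) {m : ℕ} (hm : (m : ℤ) = w * L) :
    IsBlockCode m (tapeCode f s L w) := by
  have hw0 : 0 < w := by omega
  have hwm : w ≤ w * L := by nlinarith
  refine ⟨by omega, fun c c' h => funext fun j => ?_, fun k c => funext fun i => ?_, ?_⟩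
  · have h1 := posCode_pos (c j)
    have h2 := posCode_lt (c j)
    obtain ⟨e1, e2⟩ := mul_add_ediv_emod (m := w * L) (j := j) (o := posCode (c j)) (by omega)
      (by omega)
    have h3 := congrArg Prod.fst (congrFun h (w * L * j + posCode (c j)))
    simp only [tapeCode, e1, e2, hs, h2.le, if_true, Option.some.injEq, decide_true] at h3
    exact (posCode_injective (of_decide_eq_true h3.symm)).symm
  · have e1 : (i + w * L * k) / (w * L) = i / (w * L) + k :=
      Int.add_mul_ediv_left _ _ (by omega)
    have e2 : (i + w * L * k) % (w * L) = i % (w * L) := Int.add_mul_emod_self_left _ _ _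
    have e3 : w ∣ i + w * L * k ↔ w ∣ i := by
      rw [mul_assoc]; exact dvd_add_left (dvd_mul_right _ _)
    have e4 : (i + w * L * k) / w = i / w + L * k := by
      rw [mul_assoc]; exact Int.add_mul_ediv_left _ _ hw0.ne'
    have e5 : (i + w * L * k) % w = i % w := by
      rw [mul_assoc]; exact Int.add_mul_emod_self_left _ _ _
    simp only [tapeCode, shift_apply, program, hm, e1, e2, e4, e5,
      Int.add_mul_emod_self_left]
    exact Prod.ext rfl (Prod.ext (if_congr e3.symm rfl rfl) rfl)
  · intro c c' i h r hr hr'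
    rw [hm] at hr' ⊢
    simp only [tapeCode, (mul_add_ediv_emod hr hr').1, h]

lemma headBefore_initial {L : ℤ} (c : ℤ → T) {g j : ℤ} (h : 0 ≤ L * j - g)
    (h' : L * j - g < L) : headBefore L c g j 0 = (0, false) := by
  simp [headBefore, headState, Int.ediv_eq_zero_of_lt h h', (posCode_pos _).not_gt]

lemma headBefore_final {L : ℤ} (c : ℤ → T) {g j : ℤ} (h : 3 * L ≤ L * j - g)
    (h' : L * j - g < 4 * L) : headBefore L c g j 0 = (0, false) := by
  have : (L * j - g) / L = 3 := by
    rw [show L * j - g = L * 3 + (L * j - g - 3 * L) by ring]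
    exact (mul_add_ediv_emod (by omega) (by omega)).1
  simp [headBefore, headState, this]

/-- In `3 * m` steps each head crosses three blocks and is back in its initial state, the program
moves by a multiple of its period, and block `j` has met `3 * L` heads, leaving `f (c (j - 2)) (c (j
- 1))`. -/
lemma tapeMap_iterate_tapeCode (f : T → T → T) {s L w : ℤ} (hs : s = Nat.card T + 1)
    (hL : L = Nat.card (T × T) + 1) (hw : w = 2 * (s + 1)) {m : ℕ} (hm : (m : ℤ) = w * L)
    (c : ℤ → T) :
    tapeMap^[3 * m] (tapeCode f s L w c) =
      tapeCode f s L w (shift (-2) (pairRuleMap f c)) := by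
  have hL0 : 0 < L := by omega
  have hw0 : 0 < w := by omega
  have hwm : w ≤ w * L := by nlinarith
  have hn : ((3 * m : ℕ) : ℤ) = 3 * (w * L) := by push_cast; rw [hm]
  have main := tapeMap_iterate (program f s L w) (headAt s L w c) (dataAt f s L w c) (3 * m)
    (fun h i hi hi' => meet_dataAt_headAt f hs hL0 hw c h i hi (hn ▸ hi')) _ le_rfl
  -- Data occupy offsets below `w`, so their count of heads passed is exactly `0` initially and `3 *
  -- L` at the end.
  have hdiv : ∀ i, i % (w * L) ≤ s → i / w = L * (i / (w * L)) := by
    intro i hi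
    have h1 := Int.mul_ediv_add_emod i (w * L)
    have h2 := Int.emod_nonneg i (show w * L ≠ 0 by omega)
    conv_lhs => rw [← h1, mul_assoc]
    exact (mul_add_ediv_emod h2 (by omega)).1
  have hhead : ∀ k : ℤ, k = 0 ∨ k = 3 → ∀ i,
      headAt s L w c (i - k * (w * L)) i = if w ∣ i then some (0, false) else none := by
    intro k hk i
    have e1 : w ∣ i - k * (w * L) ↔ w ∣ i := by
      rw [show i - k * (w * L) = i + w * (-(k * L)) by ring]
      exact dvd_add_left (dvd_mul_right _ _)
    simp only [headAt, e1]
    refine if_ctx_congr Iff.rfl (fun hi => congrArg some ?_) fun _ => rfl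
    obtain ⟨g, rfl⟩ := hi
    have e2 : (w * g - k * (w * L)) / w = g - k * L := by
      rw [show w * g - k * (w * L) = w * (g - k * L) by ring, Int.mul_ediv_cancel_left _ hw0.ne']
    have e3 : w * g / (w * L) = g / L := Int.mul_ediv_mul_of_pos _ _ hw0
    have e4 : w * g % (w * L) = w * (g % L) := Int.mul_emod_mul_of_pos _ _ hw0
    have h1 := Int.mul_ediv_add_emod g L
    have h2 := Int.emod_nonneg g hL0.ne'
    have h3 := Int.emod_lt_of_pos g hL0
    rw [e2, e3, e4]
    split_ifs with h4
    · have h5 : g % L = 0 := by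
        by_contra h0
        have : w * 1 ≤ w * (g % L) := by gcongr; omega
        omega
      rw [h5, mul_zero]
      rcases hk with rfl | rfl
      · exact headBefore_initial c (by omega) (by omega)
      · exact headBefore_final c (by omega) (by omega)
    · have h5 : g % L ≠ 0 := fun h0 => by rw [h0] at h4; omega
      have e5 : L * (g / L + 1) = L * (g / L) + L := by ring
      rcases hk with rfl | rfl
      · exact headBefore_initial c (by omega) (by omega)
      · exact headBefore_final c (by omega) (by omega)
  have hinit : tapeCode f s L w c = fun i =>
      (dataAt f s L w c i i, headAt s L w c i i, program f s L w i) := by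
    funext i
    have h1 := hhead 0 (Or.inl rfl) i
    rw [zero_mul, sub_zero] at h1
    rw [tapeCode, h1, dataAt]
    refine Prod.ext (if_ctx_congr Iff.rfl (fun hi => congrArg some ?_) fun _ => rfl) rfl
    rw [hdiv i hi, sub_self, Bool.eq_iff_iff, dataState_eq_true_of_le _ _ _ _ (by omega),
      decide_eq_true_eq]
  rw [hinit, main]
  funext i
  have e1 : (i + 3 * (w * L)) / w = i / w + L * 3 := by
    rw [show i + 3 * (w * L) = i + w * (L * 3) by ring]
    exact Int.add_mul_ediv_left _ _ hw0.ne'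
  have e2 : (i + 3 * (w * L)) % w = i % w := by
    rw [show i + 3 * (w * L) = i + w * (L * 3) by ring]
    exact Int.add_mul_emod_self_left _ _ _
  rw [hn, hhead 3 (Or.inr rfl), program, e1, e2, Int.add_mul_emod_self_left, tapeCode, dataAt]
  refine Prod.ext (if_ctx_congr Iff.rfl (fun hi => congrArg some ?_) fun _ => rfl) rfl
  have e3 : (i - 3 * (w * L)) / w = i / w - L * 3 := by
    rw [show i - 3 * (w * L) = i + w * (-(L * 3)) by ring,
      Int.add_mul_ediv_left _ _ hw0.ne', sub_eq_add_neg]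
  rw [e3, hdiv i hi, Bool.eq_iff_iff, dataState_eq_true_of_lt _ _ _ _ (by omega),
    decide_eq_true_eq]
  simp only [shift_apply, pairRuleMap]
  rw [show i / (w * L) + -2 + 1 = i / (w * L) - 1 by ring, ← sub_eq_add_neg]
  -- The head whose row is this very pair has passed, since pair codes range from `1` to `L - 1`.
  refine and_iff_left ⟨posCode (c (i / (w * L) - 2), c (i / (w * L) - 1)), ?_, ?_,
    row_posCode _⟩
  · have := posCode_pos (c (i / (w * L) - 2), c (i / (w * L) - 1))
    omega
  · have := posCode_lt (c (i / (w * L) - 2), c (i / (w * L) - 1))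
    omega

/-- The tape automaton simulates every automaton with neighborhood `{0, 1}`. -/
lemma tapeMap_blockSimulates (f : T → T → T) :
    ∃ m, BlockSimulates (tapeMap (A := Fin 3 × Bool) (B := Bool)) (pairRuleMap f) m (-2) := by
  obtain ⟨s, hs⟩ : ∃ s : ℤ, s = Nat.card T + 1 := ⟨_, rfl⟩
  obtain ⟨L, hL⟩ : ∃ L : ℤ, L = Nat.card (T × T) + 1 := ⟨_, rfl⟩
  obtain ⟨w, hw⟩ : ∃ w : ℤ, w = 2 * (s + 1) := ⟨_, rfl⟩
  obtain ⟨m, hm⟩ : ∃ m : ℕ, (m : ℤ) = w * L :=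
    ⟨(w * L).toNat, Int.toNat_of_nonneg (mul_nonneg (by omega) (by omega))⟩
  have hcode := isBlockCode_tapeCode f hs (show 0 < L by omega) hw hm
  exact ⟨m, 3 * m, tapeCode f s L w, Nat.mul_pos three_pos hcode.pos, hcode,
    tapeMap_iterate_tapeCode f hs hL hw hm⟩

end Universal

lemma pairRuleMap_shift {T : Type v} (f : T → T → T) (k : ℤ) (c : ℤ → T) :
    pairRuleMap f (shift k c) = shift k (pairRuleMap f c) := by
  funext i
  simp only [pairRuleMap, shift_apply, add_right_comm]

lemma blockSimulates_of_isEmpty {S : Type u} {T : Type v} [IsEmpty T] (F : (ℤ → S) → (ℤ → S))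
    (G : (ℤ → T) → (ℤ → T)) : BlockSimulates F G 1 0 := by
  have h : ∀ {P : Prop}, (ℤ → T) → P := fun c => isEmptyElim (c 0)
  exact ⟨1, fun c => isEmptyElim (c 0), one_pos,
    ⟨one_pos, fun c => h c, fun _ c => h c, fun c => h c⟩, fun c => h c⟩

theorem exists_numberConserving_intrinsicallyUniversal :
    ∃ (S : Finset ℤ) (F : CellularAutomaton S),
      F.NumberConserving ∧ IntrinsicallyUniversal.{0, v} F := by
  have hne : Nonempty (TapeCell (Fin 3 × Bool) Bool) := ⟨(none, none, id)⟩
  obtain ⟨U, hU⟩ := (isLocal_tapeMap (A := Fin 3 × Bool) (B := Bool)).exists_globalMap_eq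
  obtain ⟨N, hN, hNU⟩ := exists_numberConserving_blockSimulates U
  have : Nonempty (signedCodes (TapeCell (Fin 3 × Bool) Bool)) := hne.map posState
  refine ⟨_, N, hN, fun T _ G => ?_⟩
  rcases isEmpty_or_nonempty T with hT | hT
  · exact (blockSimulates_of_isEmpty N.globalMap G.globalMap).simulates
  · obtain ⟨w, f, k, hG⟩ := exists_pairRuleMap_blockSimulates G
    obtain ⟨m, hf⟩ := tapeMap_blockSimulates f
    -- The drift `-2` is admissible because the gathering code has blocks of one cell; below, the
    -- pair code has no drift.
    obtain ⟨k', hUG⟩ := BlockSimulates.trans (m' := 1) (k := -2) (pairRuleMap_shift f)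
      (by simpa using hf) hG
    rw [← hU] at hUG
    obtain ⟨k'', h⟩ := BlockSimulates.trans (k := 0) (isLocal_globalMap U).map_shift
      (by simpa using hNU) hUG
    exact h.simulates

end CellularAutomaton

theorem mainTheorem2 :
    ∃ (S : Finset ℤ) (F : CellularAutomaton S),
      F.NumberConserving ∧ CellularAutomaton.IntrinsicallyUniversal.{0, v} F :=
  CellularAutomaton.exists_numberConserving_intrinsicallyUniversal
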